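/- **Proposition.** Let $r\ge 1$. For a permutation $\sigma=\sigma_1\cdots\sigma_n$ of $\{1,\dots,n\}$, bordered by $\sigma_0=-\infty$ and a choice of $\sigma_{n+1}\in\{-\infty,+\infty\}$, the value $\sigma_j$ ($1\le j\le n$) is called a peak if $\sigma_{j-1}<\sigma_j>\sigma_{j+1}$, a valley if $\sigma_{j-1}>\sigma_j<\sigma_{j+1}$, a double rise if $\sigma_{j-1}<\sigma_j<\sigma_{j+1}$, and a double fall if $\sigma_{j-1}>\sigma_j>\sigma_{j+1}$. The bordered permutation is called $r$-repeated if, for each $j\ge 0$, the elements of value in $\{jr+1,jr+2,\dots,jr+r\}\cap\{1,\dots,n\}$ are all of the same one of these four types. Let $R_{rn+1}$ be the number of $r$-repeated permutations of length $rn+1$ bordered by $(-\infty,-\infty)$, and let $R^\star_{rn}$ be the number of $r$-repeated permutations of length $rn$ bordered by $(-\infty,+\infty)$. Then, as identities of formal power series (the convergents of each continued fraction are well defined and converge coefficientwise to the left-hand side), $$\sum_{\nu\ge0}R_{r\nu+1}z^{r\nu+1}=\cfrac{z}{1-c_0z^r-\cfrac{a_0z^{2r}}{1-c_1z^r-\cfrac{a_1z^{2r}}{\ddots}}},\qquad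 \sum_{\nu\ge0}R^\star_{r\nu}z^{r\nu}=\cfrac{1}{1-c^\star_0z^r-\cfrac{a^\star_0z^{2r}}{1-c^\star_1z^r-\cfrac{a^\star_1z^{2r}}{\ddots}}},$$ where, for $k\ge 0$, $$a_k=(rk+1)\,(rk+2)^2(rk+3)^2\cdots(rk+r)^2\,(rk+r+1),\qquad c_k=2\,(rk+1)^r,$$ $$a^\star_k=(rk+1)^2(rk+2)^2\cdots(rk+r)^2,\qquad c^\star_k=(rk)^r+(rk+1)^r.$$ In both fractions the numerators $a_kz^{2r}$, $a^\star_kz^{2r}$ are polynomials of degree $2r$, and the denominators $1-c_kz^r$, $1-c^\star_kz^r$ are polynomials of degree $r$, in the depth index $k$. -/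

import Mathlib

/-!  # Repeated permutations and formal Jacobi-type continued fractions  -/

namespace RepeatedPerm

/-- The four local ordinal types of an element of a permutation. -/
inductive OrdinalType where
  | peak
  | valley
  | doubleRise
  | doubleFall

/-- The ordinal type of a letter `x` whose left and right neighbours in the (bordered) word are
`l` and `s`. In all uses below `x` is distinct from both neighbours. -/
def ordinalType (l x s : WithBot (WithTop ℕ)) : OrdinalType :=
  if l < x then
    if x < s then OrdinalType.doubleRise else OrdinalType.peak
  else
    if x < s then OrdinalType.valley else OrdinalType.doubleFall

/-- The bordered word `σ₀ σ₁ ⋯ σₙ σₙ₊₁` of a permutation `σ` of `{1, …, n}`, with left border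
`σ₀ = -∞ = ⊥` and a right border `b`, which is `-∞ = ⊥` or `+∞ = ⊤`.
The set `{1, …, n}` is modelled by `Fin n`, with `i : Fin n` standing for `i + 1`. -/
def borderedWord {n : ℕ} (σ : Equiv.Perm (Fin n)) (b : WithBot (WithTop ℕ)) :
    ℕ → WithBot (WithTop ℕ)
  | 0 => ⊥
  | i + 1 => if h : i < n then (((((σ ⟨i, h⟩ : Fin n) : ℕ) + 1 : ℕ) : WithTop ℕ) :
      WithBot (WithTop ℕ)) else b

/-- The ordinal type, in the word of `σ` with right border `b`, of the element whose *value* is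
`v + 1`; this value stands at place `σ⁻¹ v + 1` of the bordered word. -/
def typeOfValue {n : ℕ} (σ : Equiv.Perm (Fin n)) (b : WithBot (WithTop ℕ)) (v : Fin n) :
    OrdinalType :=
  let p : ℕ := (σ.symm v : ℕ) + 1
  ordinalType (borderedWord σ b (p - 1)) (borderedWord σ b p) (borderedWord σ b (p + 1))

/-- `σ` is `r`-repeated (for the right border `b`): for each `j ≥ 0`, the elements of value in
`{jr+1, jr+2, …, jr+r} ∩ {1, …, n}` are all of the same ordinal type. -/
def IsRepeated (r : ℕ) {n : ℕ} (b : WithBot (WithTop ℕ)) (σ : Equiv.Perm (Fin n)) : Prop :=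
  ∀ j : ℕ, ∀ u v : Fin n,
    (u : ℕ) + 1 ∈ Finset.Icc (j * r + 1) (j * r + r) →
    (v : ℕ) + 1 ∈ Finset.Icc (j * r + 1) (j * r + r) →
    typeOfValue σ b u = typeOfValue σ b v

/-- The number of `r`-repeated permutations of length `n` bordered by `(-∞, b)`. -/
noncomputable def countRepeated (r : ℕ) (b : WithBot (WithTop ℕ)) (n : ℕ) : ℕ :=
  Nat.card {σ : Equiv.Perm (Fin n) // IsRepeated r b σ}

open Classical in
/-- The ordinary generating function `∑_{ν ≥ 0} R(rν+1) z^(rν+1)` of the `r`-repeated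
permutations of length `rν+1` bordered by `(-∞, -∞)`. -/
noncomputable def oddOGF (r : ℕ) : PowerSeries ℚ :=
  PowerSeries.mk fun m => if ∃ ν : ℕ, m = r * ν + 1 then (countRepeated r ⊥ m : ℚ) else 0

open Classical in
/-- The ordinary generating function `∑_{ν ≥ 0} R*(rν) z^(rν)` of the `r`-repeated
permutations of length `rν` bordered by `(-∞, +∞)`. -/
noncomputable def evenOGF (r : ℕ) : PowerSeries ℚ :=
  PowerSeries.mk fun m => if ∃ ν : ℕ, m = r * ν then (countRepeated r ⊤ m : ℚ) else 0

/-- The finite continued fraction `1/(d_k - a_k/(d_{k+1} - a_{k+1}/( ⋯ /d_{k+h})))`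
over the formal power series. -/
noncomputable def cfrac (a d : ℕ → PowerSeries ℚ) : ℕ → ℕ → PowerSeries ℚ
  | 0, k => (d k)⁻¹
  | h + 1, k => (d k - a k * cfrac a d h (k + 1))⁻¹

/-- The formal power series `F` is represented by the infinite continued fraction
`l/(d_0 - a_0/(d_1 - a_1/(d_2 - ⋯)))`: all the denominators that occur in the convergents are
invertible power series, and the convergents converge to `F` coefficient by coefficient
(that is, in the topology of formal power series). -/
def HasCFExpansion (F l : PowerSeries ℚ) (a d : ℕ → PowerSeries ℚ) : Prop :=
  (∀ h k, IsUnit (d k) ∧ IsUnit (d k - a k * cfrac a d h (k + 1))) ∧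
  ∀ N : ℕ, ∃ H : ℕ, ∀ h : ℕ, H ≤ h →
    PowerSeries.coeff N (l * cfrac a d h 0) = PowerSeries.coeff N F

/-- The quantity `f k` is a polynomial of degree exactly `D` in the index `k` (with coefficients
that may involve the formal variable `z`). -/
def IsPolynomialInDepth (f : ℕ → PowerSeries ℚ) (D : ℕ) : Prop :=
  ∃ P : Polynomial (PowerSeries ℚ), P.natDegree = D ∧
    ∀ k : ℕ, P.eval (k : PowerSeries ℚ) = f k

/-- `(rk+1) · (rk+2)² ⋯ (rk+r)² · (rk+r+1) · z^(2r)`. -/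
noncomputable def oddNum (r k : ℕ) : PowerSeries ℚ :=
  PowerSeries.C (((r * k + 1) * (∏ i ∈ Finset.Icc 2 r, (r * k + i) ^ 2) * (r * k + r + 1) : ℕ) : ℚ)
    * PowerSeries.X ^ (2 * r)

/-- `1 - 2 · (rk+1)^r · z^r`. -/
noncomputable def oddDen (r k : ℕ) : PowerSeries ℚ :=
  1 - PowerSeries.C ((2 * (r * k + 1) ^ r : ℕ) : ℚ) * PowerSeries.X ^ r

/-- `(rk+1)² · (rk+2)² ⋯ (rk+r)² · z^(2r)`. -/
noncomputable def evenNum (r k : ℕ) : PowerSeries ℚ :=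
  PowerSeries.C ((∏ i ∈ Finset.Icc 1 r, (r * k + i) ^ 2 : ℕ) : ℚ) * PowerSeries.X ^ (2 * r)

/-- `1 - ((rk)^r + (rk+1)^r) · z^r`. -/
noncomputable def evenDen (r k : ℕ) : PowerSeries ℚ :=
  1 - PowerSeries.C (((r * k) ^ r + (r * k + 1) ^ r : ℕ) : ℚ) * PowerSeries.X ^ r

end RepeatedPerm

/-! Build a permutation by inserting its values in increasing order. Once the values up to `m` are
present, each maximal run of larger entries is contracted to one placeholder `⊤`; no two `⊤` are
adjacent, and the process starts from the word `[⊤]`. The next value is inserted by choosing a `⊤`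
and replacing it by `m`, `⊤ m ⊤`, `m ⊤` or `⊤ m`, according as the value is a peak, a valley, a
double rise or a double fall. This is reversible, so with prescribed types the number of words is
multiplied at each step by the number of eligible `⊤` (`card_words_succ`). A right border `+∞`
belongs to a final `⊤` that has to survive, which costs one choice for the patterns not ending in
`⊤`, namely peak and double fall.

A block of `r` values of equal type changes the number of `⊤` by `-r`, `+r` or `0`. Starting from
one `⊤`, only the numbers `rj + 1` occur, and grouping words by the type of the last block gives the
recurrence of weighted Motzkin paths (`blockCount_succ_one`, `blockCount_succ`). The bijections with
permutations are `countRepeated_odd` and `countRepeated_even`.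

The recurrence becomes a three-term relation between the generating functions of the heights.
Unrolling it from height 0 produces the continued fraction, with an error whose order in `z` grows
with the depth (`pow_dvd_sub_cfrac`). -/

namespace RepeatedPerm

/-! ### Jacobi continued fractions from three-term recurrences -/

section ContinuedFraction

variable {r : ℕ}

/-- The series `∑ u ν z^(rν)`. -/
noncomputable def dilatedSeries (r : ℕ) (u : ℕ → ℚ) : PowerSeries ℚ :=
  PowerSeries.mk fun m => if r ∣ m then u (m / r) else 0

theorem dilatedSeries_eq (hr : 1 ≤ r) (u : ℕ → ℚ) :
    dilatedSeries r u = PowerSeries.C (u 0) +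
      PowerSeries.X ^ r * dilatedSeries r (fun n => u (n + 1)) := by
  ext m
  simp only [dilatedSeries, PowerSeries.coeff_mk, map_add, PowerSeries.coeff_C,
    PowerSeries.coeff_X_pow_mul']
  rcases Nat.eq_zero_or_pos m with rfl | hm
  · have : ¬ r ≤ 0 := by omega
    simp [this]
  · by_cases hrm : r ≤ m
    · have h1 : (r ∣ m - r) ↔ r ∣ m := by
        constructor
        · intro h
          have := dvd_add h (dvd_refl r)
          rwa [Nat.sub_add_cancel hrm] at this
        · intro h
          exact Nat.dvd_sub h (dvd_refl r)
      have h2 : (m - r) / r + 1 = m / r := by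
        conv_rhs => rw [← Nat.sub_add_cancel hrm]
        rw [Nat.add_div_right _ (by omega)]
      simp [hrm, h1, h2, hm.ne']
    · have : ¬ r ∣ m := fun h => hrm (Nat.le_of_dvd hm h)
      simp [hrm, this, hm.ne']

theorem dilatedSeries_add (u v : ℕ → ℚ) :
    dilatedSeries r (fun n => u n + v n) = dilatedSeries r u + dilatedSeries r v := by
  ext m
  simp only [dilatedSeries, PowerSeries.coeff_mk, map_add]
  split_ifs <;> simp

theorem dilatedSeries_const_mul (c : ℚ) (u : ℕ → ℚ) :
    dilatedSeries r (fun n => c * u n) = PowerSeries.C c * dilatedSeries r u := by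
  ext m
  simp only [dilatedSeries, PowerSeries.coeff_mk, PowerSeries.coeff_C_mul]
  split_ifs <;> simp

theorem pow_dvd_dilatedSeries (hr : 1 ≤ r) (j : ℕ) :
    ∀ u : ℕ → ℚ, (∀ n < j, u n = 0) → (PowerSeries.X : PowerSeries ℚ) ^ (r * j) ∣ dilatedSeries r u := by
  induction j with
  | zero => intro u _; simp
  | succ j ih =>
    intro u hu
    rw [dilatedSeries_eq hr, hu 0 (by omega), map_zero, zero_add, mul_add, mul_one, pow_add,
      mul_comm]
    exact mul_dvd_mul_left _ (ih _ fun n hn => hu _ (by omega))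

/-- The error in replacing a solution of a three-term recurrence by a convergent. -/
theorem pow_dvd_sub_cfrac (α β : ℕ → ℚ) (d U P : ℕ → PowerSeries ℚ)
    (hd : ∀ h k, IsUnit (d k) ∧ IsUnit (d k -
      PowerSeries.C (α k * β (k + 1)) * PowerSeries.X ^ (2 * r) * cfrac
        (fun k => PowerSeries.C (α k * β (k + 1)) * PowerSeries.X ^ (2 * r)) d h (k + 1)))
    (hU : ∀ k, PowerSeries.X ^ (r * k) ∣ U k)
    (hP : ∀ k, P (k + 1) = PowerSeries.X ^ r * (PowerSeries.C (β (k + 1)) * U k))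
    (hrec : ∀ k, d k * U k = P k + PowerSeries.X ^ r * (PowerSeries.C (α k) * U (k + 1)))
    (h : ℕ) : ∀ k, PowerSeries.X ^ (r * (k + 2 * h + 2)) ∣ U k - cfrac
      (fun k => PowerSeries.C (α k * β (k + 1)) * PowerSeries.X ^ (2 * r)) d h k * P k := by
  have inv_mul : ∀ f : PowerSeries ℚ, IsUnit f → f⁻¹ * f = 1 := by
    intro f hf
    apply PowerSeries.inv_mul_cancel
    intro h0
    have := hf.map (PowerSeries.constantCoeff (R := ℚ))
    rw [h0] at this
    simp at this
  induction h with
  | zero =>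
    intro k
    have h1 := inv_mul _ (hd 0 k).1
    have : U k - cfrac (fun k => PowerSeries.C (α k * β (k + 1)) * PowerSeries.X ^ (2 * r)) d 0 k
        * P k = PowerSeries.X ^ r * U (k + 1) * (PowerSeries.C (α k) * (d k)⁻¹) := by
      simp only [cfrac]
      linear_combination (-U k) * h1 + (d k)⁻¹ * hrec k
    rw [this]
    refine Dvd.dvd.mul_right ?_ _
    -- One factor `X ^ r` comes from the recurrence, the rest is the order of `U (k + 1)`.
    have h2 : r * (k + 2 * 0 + 2) = r + r * (k + 1) := by ring
    rw [h2, pow_add]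
    exact mul_dvd_mul_left _ (hU _)
  | succ h ih =>
    intro k
    have h1 := inv_mul _ (hd h k).2
    obtain ⟨E, hE⟩ := ih (k + 1)
    -- The error at depth `k` is `X ^ r * α k` times the error at depth `k + 1`, divided by the
    -- outer denominator.
    refine ⟨E * PowerSeries.C (α k) * (d k - PowerSeries.C (α k * β (k + 1)) *
      PowerSeries.X ^ (2 * r) * cfrac
        (fun k => PowerSeries.C (α k * β (k + 1)) * PowerSeries.X ^ (2 * r)) d h (k + 1))⁻¹, ?_⟩
    have h2 : r * (k + 2 * (h + 1) + 2) = r + r * (k + 1 + 2 * h + 2) := by ring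
    rw [h2, pow_add]
    rw [hP] at hE
    have hx : (PowerSeries.X : PowerSeries ℚ) ^ (2 * r) = PowerSeries.X ^ r * PowerSeries.X ^ r := by
      rw [← pow_add]; ring_nf
    simp only [cfrac]
    set c := cfrac (fun k => PowerSeries.C (α k * β (k + 1)) * PowerSeries.X ^ (2 * r)) d h (k + 1)
    rw [map_mul, hx] at h1 ⊢
    set D := (d k - PowerSeries.C (α k) * PowerSeries.C (β (k + 1)) *
      (PowerSeries.X ^ r * PowerSeries.X ^ r) * c)⁻¹
    linear_combination (-U k) * h1 + D * hrec k + D * PowerSeries.X ^ r * PowerSeries.C (α k) * hE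

theorem isUnit_jacobi_denominators (hr : 1 ≤ r) (α c : ℕ → ℚ) (h k : ℕ) :
    IsUnit (1 - PowerSeries.C (c k) * PowerSeries.X ^ r) ∧
    IsUnit (1 - PowerSeries.C (c k) * PowerSeries.X ^ r -
      PowerSeries.C (α k) * PowerSeries.X ^ (2 * r) * cfrac
        (fun k => PowerSeries.C (α k) * PowerSeries.X ^ (2 * r))
        (fun k => 1 - PowerSeries.C (c k) * PowerSeries.X ^ r) h (k + 1)) := by
  have : r ≠ 0 := by omega
  constructor <;> rw [PowerSeries.isUnit_iff_constantCoeff] <;> simp [this]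

/-- Weighted Motzkin paths: the path counts `u ν j` from height `j` to height `0` in `ν` steps
have the Jacobi continued fraction as generating function. -/
theorem hasCFExpansion_of_recurrence (hr : 1 ≤ r) (s : ℕ) (F : PowerSeries ℚ)
    (a d : ℕ → PowerSeries ℚ) (α β γ : ℕ → ℚ) (u : ℕ → ℕ → ℚ)
    (ha : ∀ k, a k = PowerSeries.C (α k * β (k + 1)) * PowerSeries.X ^ (2 * r))
    (hd : ∀ k, d k = 1 - PowerSeries.C (γ k) * PowerSeries.X ^ r)
    (h00 : u 0 0 = 1) (h0 : ∀ j, u 0 (j + 1) = 0)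
    (hs0 : ∀ n, u (n + 1) 0 = γ 0 * u n 0 + α 0 * u n 1)
    (hs : ∀ n j, u (n + 1) (j + 1) =
      γ (j + 1) * u n (j + 1) + α (j + 1) * u n (j + 2) + β (j + 1) * u n j)
    (hF : F = PowerSeries.X ^ s * dilatedSeries r (fun n => u n 0)) :
    HasCFExpansion F (PowerSeries.X ^ s) a d := by
  obtain rfl : a = _ := funext ha
  obtain rfl : d = _ := funext hd
  have hunit := isUnit_jacobi_denominators hr (fun k => α k * β (k + 1)) γ
  -- `H = N` suffices: the error of the convergent has order at least `r * (2 * h + 2)`, which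
  -- exceeds `N`.
  refine ⟨hunit, fun N => ⟨N, fun h hh => ?_⟩⟩
  set P : ℕ → PowerSeries ℚ := fun k => Nat.casesOn k 1 fun k =>
    PowerSeries.X ^ r * (PowerSeries.C (β (k + 1)) * dilatedSeries r (fun n => u n k)) with hPdef
  -- Height `j` is at least `j` steps away from height 0; this gives the order of the `j`-th series.
  have hvan : ∀ n j, n < j → u n j = 0 := by
    intro n
    induction n with
    | zero => intro j hj; obtain ⟨j, rfl⟩ := Nat.exists_eq_succ_of_ne_zero hj.ne'; exact h0 j
    | succ n ih =>
      intro j hj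
      obtain ⟨j, rfl⟩ := Nat.exists_eq_succ_of_ne_zero (by omega : j ≠ 0)
      simp only [Nat.succ_eq_add_one] at hj ⊢
      rw [hs, ih _ (by omega), ih _ (by omega), ih _ (by omega)]
      simp
  have key := pow_dvd_sub_cfrac (r := r) α β (fun k => 1 - PowerSeries.C (γ k) * PowerSeries.X ^ r)
    (fun k => dilatedSeries r (fun n => u n k)) P hunit
    (fun k => pow_dvd_dilatedSeries hr k _ fun n hn => hvan n k hn) (fun k => rfl)
    (by
      intro k
      rw [sub_mul, one_mul, sub_eq_iff_eq_add]
      conv_lhs => rw [dilatedSeries_eq hr]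
      cases k with
      | zero =>
        have hP0 : P 0 = 1 := rfl
        simp only [hs0, h00, map_one, hP0]
        rw [dilatedSeries_add (fun n => γ 0 * u n 0), dilatedSeries_const_mul,
          dilatedSeries_const_mul]
        ring
      | succ k =>
        simp only [hs, h0, map_zero, hPdef]
        rw [dilatedSeries_add (fun n => γ (k + 1) * u n (k + 1) + α (k + 1) * u n (k + 2)),
          dilatedSeries_add (fun n => γ (k + 1) * u n (k + 1)), dilatedSeries_const_mul,
          dilatedSeries_const_mul, dilatedSeries_const_mul]
        ring) h 0
  have hP0 : P 0 = 1 := rfl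
  rw [hP0, mul_one] at key
  rw [hF, ← sub_eq_zero, ← map_sub, ← mul_sub]
  obtain ⟨E, hE⟩ := dvd_sub_comm.1 key
  rw [hE, mul_left_comm, PowerSeries.coeff_X_pow_mul', if_neg]
  have : 1 * (0 + 2 * h + 2) ≤ r * (0 + 2 * h + 2) := Nat.mul_le_mul_right _ hr
  omega

end ContinuedFraction

/-! ### Degrees in the depth index -/

section Depth

open Polynomial

variable {r : ℕ}

/-- The linear polynomial `rX + i`. -/
noncomputable def depthFactor (r i : ℕ) : (PowerSeries ℚ)[X] :=
  C (r : PowerSeries ℚ) * X + C (i : PowerSeries ℚ)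

theorem eval_depthFactor (r i : ℕ) (x : PowerSeries ℚ) :
    (depthFactor r i).eval x = r * x + i := by
  simp [depthFactor]

theorem natCast_ne_zero_of_one_le (hr : 1 ≤ r) : (r : PowerSeries ℚ) ≠ 0 := by
  intro h
  have h0 := congrArg (PowerSeries.constantCoeff (R := ℚ)) h
  rw [map_natCast, map_zero, Nat.cast_eq_zero] at h0
  omega

theorem two_ne_zero_powerSeries : (2 : PowerSeries ℚ) ≠ 0 := by
  simpa using natCast_ne_zero_of_one_le one_le_two

theorem natDegree_depthFactor (hr : 1 ≤ r) (i : ℕ) : (depthFactor r i).natDegree = 1 :=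
  natDegree_linear (natCast_ne_zero_of_one_le hr)

theorem depthFactor_ne_zero (hr : 1 ≤ r) (i : ℕ) : depthFactor r i ≠ 0 :=
  ne_zero_of_natDegree_gt (n := 0) (by rw [natDegree_depthFactor hr]; exact zero_lt_one)

theorem natDegree_prod_depthFactor (hr : 1 ≤ r) (s : Finset ℕ) :
    (∏ i ∈ s, depthFactor r i ^ 2).natDegree = 2 * s.card := by
  rw [natDegree_prod _ _ fun i _ => pow_ne_zero _ (depthFactor_ne_zero hr i)]
  simp [natDegree_depthFactor hr, mul_comm]

theorem X_pow_ne_zero (n : ℕ) : (PowerSeries.X : PowerSeries ℚ) ^ n ≠ 0 :=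
  pow_ne_zero _ PowerSeries.X_ne_zero

theorem isPolynomialInDepth_oddNum (hr : 1 ≤ r) : IsPolynomialInDepth (oddNum r) (2 * r) := by
  have hne := depthFactor_ne_zero hr
  refine ⟨(depthFactor r 1 * (∏ i ∈ Finset.Icc 2 r, depthFactor r i ^ 2) * depthFactor r (r + 1)) *
    C (PowerSeries.X ^ (2 * r)), ?_, fun k => ?_⟩
  · have hprod : (∏ i ∈ Finset.Icc 2 r, depthFactor r i ^ 2) ≠ 0 :=
      Finset.prod_ne_zero_iff.2 fun i _ => pow_ne_zero _ (hne i)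
    rw [natDegree_mul_C (X_pow_ne_zero _), natDegree_mul (mul_ne_zero (hne _) hprod) (hne _),
      natDegree_mul (hne _) hprod, natDegree_prod_depthFactor hr, natDegree_depthFactor hr,
      natDegree_depthFactor hr, Nat.card_Icc]
    omega
  · simp [oddNum, eval_prod, add_assoc, eval_depthFactor]

theorem isPolynomialInDepth_evenNum (hr : 1 ≤ r) : IsPolynomialInDepth (evenNum r) (2 * r) := by
  refine ⟨(∏ i ∈ Finset.Icc 1 r, depthFactor r i ^ 2) * C (PowerSeries.X ^ (2 * r)),
    ?_, fun k => ?_⟩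
  · rw [natDegree_mul_C (X_pow_ne_zero _), natDegree_prod_depthFactor hr, Nat.card_Icc]
    omega
  · simp [evenNum, eval_prod, eval_depthFactor]

theorem isPolynomialInDepth_one_sub (hr : 1 ≤ r) (Q : (PowerSeries ℚ)[X])
    (hQ : Q.natDegree = r) :
    IsPolynomialInDepth (fun k => 1 - Q.eval (k : PowerSeries ℚ) * PowerSeries.X ^ r) r := by
  refine ⟨1 - Q * C (PowerSeries.X ^ r), ?_, fun k => by simp⟩
  rw [natDegree_sub_eq_right_of_natDegree_lt] <;> rw [natDegree_mul_C (X_pow_ne_zero _), hQ]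
  rw [natDegree_one]
  omega

theorem isPolynomialInDepth_oddDen (hr : 1 ≤ r) : IsPolynomialInDepth (oddDen r) r := by
  have h := isPolynomialInDepth_one_sub hr (C (2 : PowerSeries ℚ) * depthFactor r 1 ^ r) (by
    rw [natDegree_C_mul two_ne_zero_powerSeries, natDegree_pow, natDegree_depthFactor hr, mul_one])
  convert h using 2 with k
  have h2 : PowerSeries.C (2 : ℚ) = 2 := map_ofNat _ 2
  simp [oddDen, eval_depthFactor, h2]

theorem coeff_depthFactor_pow (hr : 1 ≤ r) (i : ℕ) :
    (depthFactor r i ^ r).coeff r = (r : PowerSeries ℚ) ^ r := by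
  have h := coeff_pow_of_natDegree_le (m := r) (natDegree_depthFactor hr i).le
  rw [mul_one] at h
  rw [h]
  congr 1
  simp [depthFactor]

/-- Both powers have leading coefficient `r ^ r`, and `2 * r ^ r` does not vanish in characteristic
zero, so no degree is lost in the sum. -/
theorem isPolynomialInDepth_evenDen (hr : 1 ≤ r) : IsPolynomialInDepth (evenDen r) r := by
  have h := isPolynomialInDepth_one_sub hr (depthFactor r 0 ^ r + depthFactor r 1 ^ r) (by
    apply natDegree_eq_of_le_of_coeff_ne_zero
    · apply natDegree_add_le_of_degree_le <;>
      · rw [natDegree_pow, natDegree_depthFactor hr, mul_one]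
    · rw [coeff_add, coeff_depthFactor_pow hr, coeff_depthFactor_pow hr, ← two_mul]
      exact mul_ne_zero two_ne_zero_powerSeries (pow_ne_zero _ (natCast_ne_zero_of_one_le hr)))
  convert h using 2 with k
  simp [evenDen, eval_depthFactor]

end Depth


/-! ### Words with placeholders and insertion of the largest value -/

section Words

/-- The letter standing for the value `i + 1`. -/
def letter (i : ℕ) : WithBot (WithTop ℕ) := ((i + 1 : ℕ) : WithTop ℕ)

theorem letter_lt_letter {i j : ℕ} : letter i < letter j ↔ i < j := by
  simp only [letter, WithBot.coe_lt_coe, Nat.cast_lt]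
  omega

theorem letter_injective : Function.Injective letter := fun i j h => by
  by_contra hne
  rcases lt_or_gt_of_ne hne with hij | hij <;>
  · have := letter_lt_letter.2 hij
    rw [h] at this
    exact lt_irrefl _ this

theorem letter_lt_top (i : ℕ) : letter i < ⊤ := by
  rw [letter, ← WithBot.coe_top, WithBot.coe_lt_coe]
  exact WithTop.coe_lt_top _

theorem letter_ne_top (i : ℕ) : letter i ≠ ⊤ := (letter_lt_top i).ne

theorem bot_lt_letter (i : ℕ) : ⊥ < letter i := WithBot.bot_lt_coe _

/-- The letter `y` of a word has prescribed type if it is a value, and is not adjacent to another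
`⊤` if it is `⊤`. -/
def LocalCond (t : ℕ → OrdinalType) (x y z : WithBot (WithTop ℕ)) : Prop :=
  (y = ⊤ → x ≠ ⊤ ∧ z ≠ ⊤) ∧ ∀ i, y = letter i → ordinalType x y z = t i

/-- All letters of the word `w`, bordered by `l` and `s`, satisfy `LocalCond`. -/
def AllLocal (t : ℕ → OrdinalType) :
    WithBot (WithTop ℕ) → List (WithBot (WithTop ℕ)) → WithBot (WithTop ℕ) → Prop
  | _, [], _ => True
  | l, x :: w, s => LocalCond t l x (w.headD s) ∧ AllLocal t x w s

variable {t : ℕ → OrdinalType}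

theorem localCond_top (x z : WithBot (WithTop ℕ)) : LocalCond t x ⊤ z ↔ x ≠ ⊤ ∧ z ≠ ⊤ := by
  simp [LocalCond, (letter_ne_top _).symm]

theorem localCond_letter (x z : WithBot (WithTop ℕ)) (i : ℕ) :
    LocalCond t x (letter i) z ↔ ordinalType x (letter i) z = t i := by
  simp [LocalCond, letter_ne_top, letter_injective.eq_iff]

theorem allLocal_append (A B : List (WithBot (WithTop ℕ))) (l s : WithBot (WithTop ℕ)) :
    AllLocal t l (A ++ B) s ↔ AllLocal t l A (B.headD s) ∧ AllLocal t (A.getLastD l) B s := by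
  induction A generalizing l with
  | nil => simp [AllLocal]
  | cons x A ih =>
    have h : (A ++ B).headD s = A.headD (B.headD s) := by cases A <;> simp
    simp only [List.cons_append, AllLocal, ih, h, List.getLastD_cons, and_assoc]

/-- `x` is smaller than `letter m`, unless it is `⊤`. -/
def IsLow (m : ℕ) (x : WithBot (WithTop ℕ)) : Prop := x ≠ ⊤ → x < letter m

theorem IsLow.lt_letter_iff {m : ℕ} {x : WithBot (WithTop ℕ)} (h : IsLow m x) :
    x < letter m ↔ x ≠ ⊤ :=
  ⟨fun hx => (hx.trans (letter_lt_top m)).ne, h⟩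

theorem IsLow.letter_lt_iff {m : ℕ} {x : WithBot (WithTop ℕ)} (h : IsLow m x) :
    letter m < x ↔ x = ⊤ := by
  constructor
  · intro hx
    by_contra hne
    exact lt_asymm hx (h hne)
  · rintro rfl
    exact letter_lt_top m

theorem isLow_getLastD {m : ℕ} {A : List (WithBot (WithTop ℕ))} (hA : ∀ x ∈ A, IsLow m x) :
    IsLow m (A.getLastD ⊥) := by
  rcases List.eq_nil_or_concat' A with rfl | ⟨A, x, rfl⟩
  · exact fun _ => bot_lt_letter m
  · simpa using hA x (by simp)

theorem isLow_headD {m : ℕ} {B : List (WithBot (WithTop ℕ))} (hB : ∀ x ∈ B, IsLow m x) :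
    IsLow m (B.headD ⊥) := by
  cases B with
  | nil => exact fun _ => bot_lt_letter m
  | cons x B => exact hB x (by simp)

/-- The last letter of `A` is smaller than both `letter m` and `⊤`, so its type cannot distinguish
these two right neighbours. -/
theorem allLocal_letter_right {m : ℕ} {A : List (WithBot (WithTop ℕ))}
    (hA : ∀ x ∈ A, IsLow m x) (hlast : A.getLastD ⊥ ≠ ⊤) (l : WithBot (WithTop ℕ)) :
    AllLocal t l A (letter m) ↔ AllLocal t l A ⊤ := by
  rcases List.eq_nil_or_concat' A with rfl | ⟨A, x, rfl⟩
  · rfl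
  · have hx : x ≠ ⊤ := by simpa using hlast
    have hlt : x < letter m := hA x (by simp) hx
    simp [allLocal_append, AllLocal, LocalCond, ordinalType, hlt, hlt.trans (letter_lt_top m), hx]

theorem allLocal_letter_left {m : ℕ} {B : List (WithBot (WithTop ℕ))}
    (hB : ∀ x ∈ B, IsLow m x) (hhead : B.headD ⊥ ≠ ⊤) (s : WithBot (WithTop ℕ)) :
    AllLocal t (letter m) B s ↔ AllLocal t ⊤ B s := by
  cases B with
  | nil => rfl
  | cons x B =>
    have hx : x ≠ ⊤ := by simpa using hhead
    have hlt : ¬ letter m < x := (hB x (by simp) hx).le.not_gt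
    simp [AllLocal, LocalCond, ordinalType, hlt, hx]

/-- The part of the local pattern of the largest value of a word that precedes it. -/
def leftPattern : OrdinalType → List (WithBot (WithTop ℕ))
  | .peak => []
  | .valley => [⊤]
  | .doubleRise => []
  | .doubleFall => [⊤]

/-- The part of the local pattern of the largest value of a word that follows it. -/
def rightPattern : OrdinalType → List (WithBot (WithTop ℕ))
  | .peak => []
  | .valley => [⊤]
  | .doubleRise => [⊤]
  | .doubleFall => []

/-- The replacement of a marked `⊤` by the value `m`, with type `T`. -/
def insertLetter (m : ℕ) (T : OrdinalType)
    (p : List (WithBot (WithTop ℕ)) × List (WithBot (WithTop ℕ))) : List (WithBot (WithTop ℕ)) :=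
  (p.1 ++ leftPattern T) ++ letter m :: (rightPattern T ++ p.2)

/-- Every neighbour other than `⊤` is smaller than `letter m`; hence the type records exactly which
neighbours are `⊤`. -/
theorem ordinalType_letter {m : ℕ} {x z : WithBot (WithTop ℕ)} (hx : IsLow m x) (hz : IsLow m z)
    (T : OrdinalType) : ordinalType x (letter m) z = T ↔
      (x = ⊤ ↔ leftPattern T = [⊤]) ∧ (z = ⊤ ↔ rightPattern T = [⊤]) := by
  simp only [ordinalType, hx.lt_letter_iff, hz.letter_lt_iff]
  cases T <;> by_cases h1 : x = ⊤ <;> by_cases h2 : z = ⊤ <;>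
    simp [h1, h2, leftPattern, rightPattern]

theorem isLow_letter (m : ℕ) {i : ℕ} (hi : i < m) : IsLow m (letter i) :=
  fun _ => letter_lt_letter.2 hi

/-- Each neighbour of the marked `⊤` still sees a larger letter on that side after the replacement,
so the older types survive, and the pattern is the one that gives `letter m` its type. -/
theorem allLocal_insertLetter {m : ℕ} {A B : List (WithBot (WithTop ℕ))}
    (hA : ∀ x ∈ A, IsLow m x) (hB : ∀ x ∈ B, IsLow m x) :
    AllLocal t ⊥ (insertLetter m (t m) (A, B)) ⊥ ↔ AllLocal t ⊥ (A ++ ⊤ :: B) ⊥ := by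
  have htop : IsLow m ⊤ := fun h => (h rfl).elim
  have h1 := ordinalType_letter (isLow_getLastD hA) (isLow_headD hB) (t m)
  have h2 := ordinalType_letter (isLow_getLastD hA) htop (t m)
  have h3 := ordinalType_letter htop (isLow_headD hB) (t m)
  have h4 := ordinalType_letter htop htop (t m)
  have h5 := fun h l => allLocal_letter_right (t := t) hA h l
  have h6 := fun h s => allLocal_letter_left (t := t) hB h s
  generalize hT : t m = T at *
  -- If `A` ends or `B` begins with `⊤`, both sides fail: on the right two `⊤` are adjacent, on the
  -- left either this happens too or `letter m` gets the wrong type.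
  cases T <;> by_cases ha : A.getLastD ⊥ = ⊤ <;> by_cases hb : B.headD ⊥ = ⊤ <;>
    simp only [insertLetter, leftPattern, rightPattern, allLocal_append, AllLocal, List.nil_append,
      List.append_nil, List.headD_cons, List.cons_append, localCond_letter, localCond_top,
      List.getLastD_concat, hT, h1, h2, h3, h4] <;>
    simp_all [letter_ne_top, leftPattern, rightPattern]

/-- The multiset of letters of a word: the values up to `m`, and `k` times `⊤`. -/
def content (m k : ℕ) : Multiset (WithBot (WithTop ℕ)) :=
  Multiset.replicate k ⊤ + (Multiset.range m).map letter

theorem content_succ_left (m k : ℕ) : content (m + 1) k = letter m ::ₘ content m k := by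
  simp [content, Multiset.range_succ]

theorem content_succ_right (m k : ℕ) : content m (k + 1) = ⊤ ::ₘ content m k := by
  simp [content, Multiset.replicate_succ]

theorem mem_content {m k : ℕ} {x : WithBot (WithTop ℕ)} (hx : x ∈ content m k) :
    x = ⊤ ∨ ∃ i < m, letter i = x := by
  simp only [content, Multiset.mem_add, Multiset.mem_map, Multiset.mem_range] at hx
  exact hx.imp (Multiset.eq_of_mem_replicate) id

theorem isLow_of_mem_content {m k : ℕ} {x : WithBot (WithTop ℕ)} (hx : x ∈ content m k) :
    IsLow m x := by
  rcases mem_content hx with rfl | ⟨i, hi, rfl⟩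
  · exact fun h => (h rfl).elim
  · exact isLow_letter m hi

theorem count_top_content (m k : ℕ) : (content m k).count ⊤ = k := by
  simp only [content, Multiset.count_add, Multiset.count_replicate_self, Nat.add_eq_left]
  rw [Multiset.count_eq_zero]
  simp [letter_ne_top]

theorem coe_append_cons {α : Type*} (A B : List α) (x : α) :
    ((A ++ x :: B : List α) : Multiset α) = x ::ₘ ((A ++ B : List α) : Multiset α) :=
  Multiset.coe_eq_coe.2 List.perm_middle

theorem getLastD_append_cons {α : Type*} (A B : List α) (x l : α) :
    (A ++ x :: B).getLastD l = B.getLastD x := by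
  induction A generalizing l with
  | nil => rw [List.nil_append, List.getLastD_cons]
  | cons y A ih => rw [List.cons_append, List.getLastD_cons, ih]

theorem coe_insertLetter_eq_content {m k k' : ℕ} {T : OrdinalType}
    (hk : k + 1 = k' + (leftPattern T).length + (rightPattern T).length)
    (A B : List (WithBot (WithTop ℕ))) :
    (insertLetter m T (A, B) : Multiset (WithBot (WithTop ℕ))) = content (m + 1) k ↔
      ((A ++ ⊤ :: B : List (WithBot (WithTop ℕ))) : Multiset (WithBot (WithTop ℕ))) =
        content m k' := by
  cases T <;> simp only [leftPattern, rightPattern, List.length_nil, List.length_cons] at hk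
  · obtain rfl : k' = k + 1 := by omega
    simp only [insertLetter, leftPattern, rightPattern, List.append_nil, List.nil_append,
      coe_append_cons, content_succ_left, content_succ_right, Multiset.cons_inj_right]
  · obtain rfl : k = k' + 1 := by omega
    simp only [insertLetter, leftPattern, rightPattern, List.append_assoc, List.cons_append,
      List.nil_append, coe_append_cons, content_succ_left, content_succ_right]
    rw [Multiset.cons_swap, Multiset.cons_inj_right, Multiset.cons_inj_right]
  · obtain rfl : k = k' := by omega
    simp only [insertLetter, leftPattern, rightPattern, List.append_nil, List.cons_append,
      List.nil_append, coe_append_cons, content_succ_left, Multiset.cons_inj_right]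
  · obtain rfl : k = k' := by omega
    simp only [insertLetter, leftPattern, rightPattern, List.append_assoc, List.cons_append,
      List.nil_append, coe_append_cons, content_succ_left]
    rw [Multiset.cons_swap, Multiset.cons_inj_right]

open Classical in
/-- The words with values `1, …, m` of types `t` and `k` times `⊤`; if `e` holds, only those that
end in `⊤`. -/
noncomputable def words (e : Bool) (t : ℕ → OrdinalType) (m k : ℕ) :
    Finset (List (WithBot (WithTop ℕ))) :=
  (content m k).lists.toFinset.filter fun w =>
    AllLocal t ⊥ w ⊥ ∧ (e = true → w.getLastD ⊥ = ⊤)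

theorem mem_words {e : Bool} {m k : ℕ} {w : List (WithBot (WithTop ℕ))} :
    w ∈ words e t m k ↔ (w : Multiset (WithBot (WithTop ℕ))) = content m k ∧
      AllLocal t ⊥ w ⊥ ∧ (e = true → w.getLastD ⊥ = ⊤) := by
  simp only [words, Finset.mem_filter, Multiset.mem_toFinset, Multiset.mem_lists_iff]
  exact and_congr_left' eq_comm

end Words

/-! ### Marked occurrences of a letter -/

section Splits

variable {α : Type*} [DecidableEq α]

/-- All ways to write a list as `A ++ a :: B`. -/
def splits (a : α) : List α → Finset (List α × List α)
  | [] => ∅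
  | x :: w => (if x = a then {([], w)} else ∅) ∪ (splits a w).image fun p => (x :: p.1, p.2)

theorem mem_splits {a : α} {w : List α} {p : List α × List α} :
    p ∈ splits a w ↔ p.1 ++ a :: p.2 = w := by
  induction w generalizing p with
  | nil => simp [splits]
  | cons x w ih =>
    obtain ⟨A, B⟩ := p
    simp only [splits, Finset.mem_union, Finset.mem_image, Prod.exists, ih]
    cases A with
    | nil =>
      split_ifs with h
      · simp [h, eq_comm]
      · simp [Ne.symm h]
    | cons y A =>
      split_ifs with h
      · simp [eq_comm, and_comm]
      · simp [eq_comm, and_comm]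

theorem card_splits (a : α) (w : List α) : (splits a w).card = w.count a := by
  induction w with
  | nil => rfl
  | cons x w ih =>
    rw [splits, Finset.card_union_of_disjoint, Finset.card_image_of_injective, ih,
      List.count_cons]
    · split_ifs with h h' h' <;> simp_all [add_comm]
    · rintro ⟨A, B⟩ ⟨A', B'⟩ h
      simpa using h
    · rw [Finset.disjoint_left]
      rintro ⟨A, B⟩ h1 h2
      split_ifs at h1 <;> simp at h1 h2
      simp [h1.1] at h2

/-- Exactly one occurrence, the final one, has nothing after it. -/
theorem card_splits_filter_ne_nil (a : α) (w : List α) :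
    ((splits a (w ++ [a])).filter fun p => p.2 ≠ []).card = (w ++ [a]).count a - 1 := by
  have h := Finset.card_filter_add_card_filter_not (s := splits a (w ++ [a])) (fun p => p.2 = [])
  have h1 : (splits a (w ++ [a])).filter (fun p => p.2 = []) = {(w, [])} := by
    ext ⟨A, B⟩
    simp only [Finset.mem_filter, mem_splits, Finset.mem_singleton, Prod.mk.injEq]
    constructor
    · rintro ⟨h, rfl⟩
      exact ⟨List.append_cancel_right h, rfl⟩
    · rintro ⟨rfl, rfl⟩
      exact ⟨rfl, rfl⟩
  rw [h1, Finset.card_singleton, card_splits] at h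
  simp only [ne_eq]
  omega

end Splits

/-! ### Counting the insertions of one value -/

section Recurrence

variable {t : ℕ → OrdinalType}

/-- The number of `⊤` that may be replaced by a value of type `T`. -/
def slots (e : Bool) (T : OrdinalType) (k : ℕ) : ℕ :=
  if e = true ∧ rightPattern T = [] then k - 1 else k

/-- In the word made from `p` the letter `m` occurs only once, so it fixes the place of the cut; the
patterns then cancel. -/
theorem insertLetter_injective_of_isLow {m : ℕ} (T : OrdinalType)
    {p q : List (WithBot (WithTop ℕ)) × List (WithBot (WithTop ℕ))}
    (hp : (∀ x ∈ p.1, IsLow m x) ∧ ∀ x ∈ p.2, IsLow m x)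
    (h : insertLetter m T p = insertLetter m T q) : p = q := by
  have hlow : ∀ A : List (WithBot (WithTop ℕ)), (∀ x ∈ A, IsLow m x) → letter m ∉ A :=
    fun A hA hm => lt_irrefl _ (hA _ hm (letter_ne_top m))
  have h1 : letter m ∉ p.1 ++ leftPattern T := by
    rw [List.mem_append, not_or]
    exact ⟨hlow _ hp.1, by cases T <;> simp [leftPattern, letter_ne_top]⟩
  have h2 : letter m ∉ rightPattern T ++ p.2 := by
    rw [List.mem_append, not_or]
    exact ⟨by cases T <;> simp [rightPattern, letter_ne_top], hlow _ hp.2⟩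
  obtain ⟨h3, -, h4⟩ := (List.append_cons_inj_of_notMem h1 h2).1 h
  exact Prod.ext (List.append_cancel_right h3) (List.append_cancel_left h4)

/-- The type of the largest value tells which of its neighbours are `⊤`, so the pattern around it is
present in the word and can be stripped off. -/
theorem exists_insertLetter {m k : ℕ} {w : List (WithBot (WithTop ℕ))}
    (hw : (w : Multiset (WithBot (WithTop ℕ))) = content (m + 1) k) (hl : AllLocal t ⊥ w ⊥) :
    ∃ A B, insertLetter m (t m) (A, B) = w := by
  have hm : letter m ∈ w := by
    rw [← Multiset.mem_coe, hw, content_succ_left]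
    exact Multiset.mem_cons_self _ _
  obtain ⟨X, Y, rfl⟩ := List.append_of_mem hm
  have hXY : ((X ++ Y : List _) : Multiset (WithBot (WithTop ℕ))) = content m k := by
    rwa [content_succ_left, coe_append_cons, Multiset.cons_inj_right] at hw
  have hmem : ∀ x ∈ X ++ Y, IsLow m x := fun x hx =>
    isLow_of_mem_content (k := k) (hXY ▸ Multiset.mem_coe.2 hx)
  have hX : ∀ x ∈ X, IsLow m x := fun x hx => hmem x (List.mem_append_left _ hx)
  have hY : ∀ x ∈ Y, IsLow m x := fun x hx => hmem x (List.mem_append_right _ hx)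
  have h := ((allLocal_append _ _ _ _).1 hl).2.1
  rw [localCond_letter, ordinalType_letter (isLow_getLastD hX) (isLow_headD hY)] at h
  obtain ⟨A, hA⟩ : ∃ A, A ++ leftPattern (t m) = X := by
    rcases List.eq_nil_or_concat' X with rfl | ⟨A, x, rfl⟩
    · refine ⟨[], ?_⟩
      have h1 := h.1
      cases hT : t m <;> simp_all [leftPattern]
    · have h1 := h.1
      cases hT : t m <;> simp_all [leftPattern]
  obtain ⟨B, hB⟩ : ∃ B, rightPattern (t m) ++ B = Y := by
    have h1 := h.2
    cases Y <;> cases hT : t m <;> simp_all [rightPattern]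
  exact ⟨A, B, by rw [insertLetter, hA, hB]⟩

/-- Insertion is a bijection from smaller words with an eligible marked `⊤`; `hk` balances the
placeholders, one being consumed and those of the pattern created. -/
theorem card_words_succ {e : Bool} {m k k' : ℕ}
    (hk : k + 1 = k' + (leftPattern (t m)).length + (rightPattern (t m)).length) :
    (words e t (m + 1) k).card = slots e (t m) k' * (words e t m k').card := by
  classical
  -- Only replacing the final `⊤` can affect the last letter, and then the right pattern has to
  -- supply a new final `⊤`.
  have hlast : ∀ A B : List (WithBot (WithTop ℕ)),
      (insertLetter m (t m) (A, B)).getLastD ⊥ = ⊤ ↔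
        (A ++ ⊤ :: B).getLastD ⊥ = ⊤ ∧ (B = [] → rightPattern (t m) ≠ []) := by
    intro A B
    rcases List.eq_nil_or_concat' B with rfl | ⟨B, x, rfl⟩
    · cases t m <;> simp [insertLetter, leftPattern, rightPattern, letter_ne_top]
    · rw [getLastD_append_cons, List.getLastD_concat]
      cases t m <;> simp only [insertLetter, leftPattern, rightPattern, List.cons_append,
        List.nil_append, getLastD_append_cons, List.getLastD_cons] <;> simp
  have hlow : ∀ p ∈ (words e t m k').biUnion (splits ⊤),
      (∀ x ∈ p.1, IsLow m x) ∧ ∀ x ∈ p.2, IsLow m x := by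
    intro p hp
    simp only [Finset.mem_biUnion, mem_splits] at hp
    obtain ⟨w, hw, rfl⟩ := hp
    have hc := (mem_words.1 hw).1
    constructor <;> intro x hx <;> refine isLow_of_mem_content (k := k') ?_ <;>
      rw [← hc, Multiset.mem_coe] <;> simp [hx]
  have himage : words e t (m + 1) k = (((words e t m k').biUnion (splits ⊤)).filter fun p =>
      e = true → p.2 = [] → rightPattern (t m) ≠ []).image (insertLetter m (t m)) := by
    ext w
    simp only [Finset.mem_image, Finset.mem_filter]
    constructor
    · intro hw
      obtain ⟨h1, h2, h3⟩ := mem_words.1 hw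
      obtain ⟨A, B, rfl⟩ := exists_insertLetter h1 h2
      have hc := (coe_insertLetter_eq_content hk A B).1 h1
      have hA : ∀ x ∈ A, IsLow m x := fun x hx => isLow_of_mem_content (k := k') <| by
        rw [← hc, Multiset.mem_coe]; simp [hx]
      have hB : ∀ x ∈ B, IsLow m x := fun x hx => isLow_of_mem_content (k := k') <| by
        rw [← hc, Multiset.mem_coe]; simp [hx]
      refine ⟨(A, B), ⟨?_, fun he => ((hlast A B).1 (h3 he)).2⟩, rfl⟩
      simp only [Finset.mem_biUnion, mem_splits]
      exact ⟨_, mem_words.2 ⟨hc, (allLocal_insertLetter hA hB).1 h2,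
        fun he => ((hlast A B).1 (h3 he)).1⟩, rfl⟩
    · rintro ⟨⟨A, B⟩, ⟨hp, he⟩, rfl⟩
      have hAB := hlow _ hp
      simp only [Finset.mem_biUnion, mem_splits] at hp
      obtain ⟨w, hw, rfl⟩ := hp
      obtain ⟨h1, h2, h3⟩ := mem_words.1 hw
      exact mem_words.2 ⟨(coe_insertLetter_eq_content hk A B).2 h1,
        (allLocal_insertLetter hAB.1 hAB.2).2 h2, fun h => (hlast A B).2 ⟨h3 h, he h⟩⟩
  rw [himage, Finset.card_image_of_injOn, Finset.filter_biUnion, Finset.card_biUnion,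
    Finset.sum_const_nat (m := slots e (t m) k'), mul_comm]
  · intro w hw
    obtain ⟨h1, h2, h3⟩ := mem_words.1 hw
    have hcount : w.count ⊤ = k' := by
      rw [← Multiset.coe_count, h1, count_top_content]
    unfold slots
    split_ifs with hc
    -- Here the final `⊤` of `w` is not eligible, which leaves `k' - 1` choices.
    · rcases List.eq_nil_or_concat' w with rfl | ⟨w, x, rfl⟩
      · simp at h3
        simp_all
      · obtain rfl : x = ⊤ := by simpa using h3 hc.1
        rw [← hcount, ← card_splits_filter_ne_nil]
        simp [hc]
    · rw [Finset.filter_true_of_mem, card_splits, hcount]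
      intro p _ he _ hr
      exact hc ⟨he, hr⟩
  · intro w _ w' _ hne
    rw [Function.onFun, Finset.disjoint_left]
    intro p hp hp'
    simp only [Finset.mem_filter, mem_splits] at hp hp'
    exact hne (hp.1.symm.trans hp'.1)
  · intro p hp q hq h
    exact insertLetter_injective_of_isLow _ (hlow p (Finset.mem_filter.1 hp).1) h

end Recurrence


/-! ### Blocks of equal type and the Motzkin recurrence -/

section Blocks

variable {t : ℕ → OrdinalType} {e : Bool}

/-- Each peak uses up one `⊤`. Removing values from the top raises the number of `⊤`, so `k` has to
vary in the induction. -/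
theorem card_words_of_peaks (m : ℕ) : ∀ (n k : ℕ), (∀ i < n, t (m + i) = .peak) →
    (words e t (m + n) k).card =
      (∏ i ∈ Finset.range n, slots e .peak (k + 1 + i)) * (words e t m (k + n)).card := by
  intro n
  induction n with
  | zero => simp
  | succ n ih =>
    intro k ht
    have hn := ht n (by omega)
    rw [← add_assoc, card_words_succ (k' := k + 1) (by simp [hn, leftPattern, rightPattern]), hn,
      ih (k + 1) fun i hi => ht i (by omega), Finset.prod_range_succ', mul_comm _ (slots e _ _),
      ← mul_assoc]
    simp only [add_comm, add_left_comm]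

theorem card_words_of_flat {T : OrdinalType} (hT : T = .doubleRise ∨ T = .doubleFall) (m k : ℕ) :
    ∀ n : ℕ, (∀ i < n, t (m + i) = T) →
      (words e t (m + n) k).card = slots e T k ^ n * (words e t m k).card := by
  intro n
  induction n with
  | zero => simp
  | succ n ih =>
    intro ht
    have hn := ht n (by omega)
    rw [← add_assoc, card_words_succ (k' := k)
      (by rcases hT with rfl | rfl <;> simp [hn, leftPattern, rightPattern]), hn,
      ih fun i hi => ht i (by omega)]
    ring

theorem card_words_of_valleys (m k : ℕ) : ∀ n : ℕ, (∀ i < n, t (m + i) = .valley) →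
    (words e t (m + n) (k + n)).card =
      (∏ i ∈ Finset.range n, slots e .valley (k + i)) * (words e t m k).card := by
  intro n
  induction n with
  | zero => simp
  | succ n ih =>
    intro ht
    have hn := ht n (by omega)
    rw [← add_assoc, ← add_assoc, card_words_succ (k' := k + n)
      (by simp [hn, leftPattern, rightPattern]), hn,
      ih fun i hi => ht i (by omega), Finset.prod_range_succ]
    ring

/-- A valley has a `⊤` on both sides, so its predecessor word would have no `⊤` to replace. -/
theorem card_words_one_of_valley (m : ℕ) (ht : t m = .valley) :
    (words e t (m + 1) 1).card = 0 := by
  rw [card_words_succ (k' := 0) (by simp [ht, leftPattern, rightPattern]), ht]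
  simp [slots]

theorem allLocal_congr {t' : ℕ → OrdinalType} {w : List (WithBot (WithTop ℕ))}
    (h : ∀ i, letter i ∈ w → t i = t' i) (l s : WithBot (WithTop ℕ)) :
    AllLocal t l w s ↔ AllLocal t' l w s := by
  induction w generalizing l with
  | nil => rfl
  | cons x w ih =>
    have hx : ∀ y z, LocalCond t y x z ↔ LocalCond t' y x z := fun y z => by
      refine and_congr_right' (forall_congr' fun i => imp_congr_right fun hi => ?_)
      rw [h i (by simp [← hi])]
    simp only [AllLocal, hx, ih fun i hi => h i (List.mem_cons_of_mem _ hi)]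

theorem words_congr {t' : ℕ → OrdinalType} {m : ℕ} (h : ∀ i < m, t i = t' i) (k : ℕ) :
    words e t m k = words e t' m k := by
  ext w
  rw [mem_words, mem_words]
  refine and_congr_right fun hw => and_congr_left' (allLocal_congr (fun i hi => h i ?_) _ _)
  rw [← Multiset.mem_coe, hw] at hi
  rcases mem_content hi with hi | ⟨j, hj, hij⟩
  · exact (letter_ne_top i hi).elim
  · rwa [← letter_injective hij]

theorem card_words_zero_one : (words e t 0 1).card = 1 := by
  rw [Finset.card_eq_one]
  refine ⟨[⊤], ?_⟩
  ext w
  rw [mem_words, Finset.mem_singleton]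
  constructor
  · rintro ⟨h, -, -⟩
    simpa [content] using h
  · rintro rfl
    simp [content, AllLocal, localCond_top]

/-- With no values present, two `⊤` would be adjacent. -/
theorem card_words_zero (k : ℕ) : (words e t 0 (k + 2)).card = 0 := by
  rw [Finset.card_eq_zero, Finset.eq_empty_iff_forall_notMem]
  intro w hw
  obtain ⟨h, hl, -⟩ := mem_words.1 hw
  have hw' : w = List.replicate (k + 2) ⊤ := by
    rw [content, Multiset.range_zero, Multiset.map_zero, add_zero,
      ← Multiset.coe_replicate, Multiset.coe_eq_coe] at h
    exact List.perm_replicate.1 h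
  rw [hw'] at hl
  simp [List.replicate_succ, AllLocal, localCond_top] at hl

instance : Fintype OrdinalType :=
  ⟨⟨([.peak, .valley, .doubleRise, .doubleFall] : List OrdinalType), by simp⟩,
    fun T => by cases T <;> simp⟩

theorem sum_ordinalType {M : Type*} [AddCommMonoid M] (f : OrdinalType → M) :
    ∑ T, f T = f .peak + f .valley + f .doubleRise + f .doubleFall := by
  have : (Finset.univ : Finset OrdinalType).val =
    ([.peak, .valley, .doubleRise, .doubleFall] : List OrdinalType) := rfl
  simp [Finset.sum, this, add_assoc]

/-- The types of the values when the `j`-th block of `r` values has type `s j`. -/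
def blockTypes (r : ℕ) {n : ℕ} (s : Fin n → OrdinalType) (i : ℕ) : OrdinalType :=
  -- The default `.peak` is harmless: the counts below use only values inside the `n` blocks.
  if h : i / r < n then s ⟨i / r, h⟩ else .peak

variable {r : ℕ}

theorem blockTypes_snoc_of_lt {n i : ℕ} (s : Fin n → OrdinalType) (T : OrdinalType)
    (hi : i < r * n) :
    blockTypes r (Fin.snoc s T : Fin (n + 1) → OrdinalType) i = blockTypes r s i := by
  have h : i / r < n := Nat.div_lt_of_lt_mul hi
  rw [blockTypes, blockTypes, dif_pos h, dif_pos (h.trans (Nat.lt_succ_self n))]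
  exact Fin.snoc_castSucc (α := fun _ => OrdinalType) T s ⟨i / r, h⟩

theorem blockTypes_snoc_add {n i : ℕ} (s : Fin n → OrdinalType) (T : OrdinalType) (hi : i < r) :
    blockTypes r (Fin.snoc s T : Fin (n + 1) → OrdinalType) (r * n + i) = T := by
  have h : (r * n + i) / r = n := by
    rw [Nat.mul_add_div (by omega), Nat.div_eq_of_lt hi, add_zero]
  rw [blockTypes, dif_pos (by omega)]
  simp only [h]
  exact Fin.snoc_last (α := fun _ => OrdinalType) T s

/-- The number of words with `n` complete blocks of values and `k` times `⊤`. -/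
noncomputable def blockCount (e : Bool) (r n k : ℕ) : ℕ :=
  ∑ s : Fin n → OrdinalType, (words e (blockTypes r s) (r * n) k).card

theorem sum_snoc {M : Type*} [AddCommMonoid M] {n : ℕ} (f : (Fin (n + 1) → OrdinalType) → M) :
    ∑ s, f s = ∑ T, ∑ s : Fin n → OrdinalType, f (Fin.snoc s T : Fin (n + 1) → OrdinalType) := by
  rw [← Fintype.sum_prod_type' (f := fun T s => f (Fin.snoc s T : Fin (n + 1) → OrdinalType))]
  exact (Equiv.sum_comp (Fin.snocEquiv fun _ => OrdinalType) f).symm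

theorem blockCount_zero_one : blockCount e r 0 1 = 1 := by
  simp [blockCount, card_words_zero_one]

theorem blockCount_zero (k : ℕ) : blockCount e r 0 (k + 2) = 0 := by
  simp [blockCount, card_words_zero]

theorem card_words_snoc {n : ℕ} (s : Fin n → OrdinalType) (T : OrdinalType) (k : ℕ) :
    (words e (blockTypes r (Fin.snoc s T : Fin (n + 1) → OrdinalType)) (r * n) k).card =
      (words e (blockTypes r s) (r * n) k).card := by
  rw [words_congr fun i hi => blockTypes_snoc_of_lt s T hi]

/-- Boundary case of the recurrence: the last block cannot consist of valleys, so there is no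
contribution from below. -/
theorem blockCount_succ_one (hr : 1 ≤ r) (n : ℕ) :
    blockCount e r (n + 1) 1 =
      (slots e .doubleRise 1 ^ r + slots e .doubleFall 1 ^ r) * blockCount e r n 1 +
      (∏ i ∈ Finset.range r, slots e .peak (2 + i)) * blockCount e r n (r + 1) := by
  rw [blockCount, sum_snoc, sum_ordinalType, mul_add_one]
  have hv : ∀ s : Fin n → OrdinalType, (words e (blockTypes r
      (Fin.snoc s .valley : Fin (n + 1) → OrdinalType)) (r * n + r) 1).card = 0 := by
    intro s
    obtain ⟨q, rfl⟩ := Nat.exists_eq_add_of_le' hr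
    exact card_words_one_of_valley _ (blockTypes_snoc_add s _ (Nat.lt_succ_self q))
  simp only [hv, card_words_of_peaks _ r 1 fun i hi => blockTypes_snoc_add _ _ hi,
    card_words_of_flat (.inl rfl) _ 1 r fun i hi => blockTypes_snoc_add _ _ hi,
    card_words_of_flat (.inr rfl) _ 1 r fun i hi => blockTypes_snoc_add _ _ hi,
    card_words_snoc, ← Finset.mul_sum, Finset.sum_const_zero]
  simp only [blockCount, add_comm 1 r, one_add_one_eq_two]
  ring

/-- Sum over the type of the last block: before it there were `r` more `⊤` for peaks, `r` fewer for
valleys, and equally many for the two flat types. -/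
theorem blockCount_succ (n k : ℕ) :
    blockCount e r (n + 1) (k + r) =
      (slots e .doubleRise (k + r) ^ r + slots e .doubleFall (k + r) ^ r) *
        blockCount e r n (k + r) +
      (∏ i ∈ Finset.range r, slots e .peak (k + r + 1 + i)) * blockCount e r n (k + r + r) +
      (∏ i ∈ Finset.range r, slots e .valley (k + i)) * blockCount e r n k := by
  rw [blockCount, sum_snoc, sum_ordinalType, mul_add_one]
  simp only [card_words_of_peaks _ r _ fun i hi => blockTypes_snoc_add _ _ hi,
    card_words_of_valleys _ k r fun i hi => blockTypes_snoc_add _ _ hi,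
    card_words_of_flat (.inl rfl) _ _ r fun i hi => blockTypes_snoc_add _ _ hi,
    card_words_of_flat (.inr rfl) _ _ r fun i hi => blockTypes_snoc_add _ _ hi,
    card_words_snoc, ← Finset.mul_sum]
  simp only [blockCount]
  ring

end Blocks

/-! ### From words to permutations -/

section Permutations

variable {t : ℕ → OrdinalType} {n : ℕ}

/-- Prepending `l` moves `w[i]` to place `i + 1`, whence its neighbours stand at `i` and `i + 2`. -/
theorem allLocal_iff_forall_getD (w : List (WithBot (WithTop ℕ))) (l s : WithBot (WithTop ℕ)) :
    AllLocal t l w s ↔ ∀ i (h : i < w.length),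
      LocalCond t ((l :: (w ++ [s])).getD i ⊥) w[i] ((l :: (w ++ [s])).getD (i + 2) ⊥) := by
  induction w generalizing l with
  | nil => simp [AllLocal]
  | cons x w ih =>
    rw [AllLocal, ih]
    constructor
    · rintro ⟨h1, h2⟩ (_ | i) hi
      · cases w <;> simpa using h1
      · exact h2 i (by simpa using hi)
    · intro h
      refine ⟨?_, fun i hi => h (i + 1) (by simpa using hi)⟩
      have := h 0 (by simp)
      cases w <;> simpa using this

/-- The word of a permutation, without borders. -/
def permWord (σ : Equiv.Perm (Fin n)) : List (WithBot (WithTop ℕ)) :=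
  List.ofFn fun i => letter (σ i)

theorem borderedWord_eq_getD (σ : Equiv.Perm (Fin n)) (b : WithBot (WithTop ℕ)) {i : ℕ}
    (hi : i ≤ n + 1) : borderedWord σ b i = (⊥ :: (permWord σ ++ [b])).getD i ⊥ := by
  cases i with
  | zero => rfl
  | succ i =>
    by_cases h : i < n
    · simp [borderedWord, permWord, h, List.getD, letter, List.getElem?_append]
    · obtain rfl : i = n := by omega
      simp [borderedWord, permWord]

theorem allLocal_permWord (σ : Equiv.Perm (Fin n)) (b : WithBot (WithTop ℕ)) :
    AllLocal t ⊥ (permWord σ) b ↔ ∀ v, typeOfValue σ b v = t v := by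
  rw [allLocal_iff_forall_getD, ← σ.forall_congr_right]
  have hlen : (permWord σ).length = n := by simp [permWord]
  have key : ∀ i : Fin n, typeOfValue σ b (σ i) = t (σ i) ↔
      LocalCond t ((⊥ :: (permWord σ ++ [b])).getD i ⊥) (letter (σ i))
        ((⊥ :: (permWord σ ++ [b])).getD (i + 2) ⊥) := by
    intro i
    rw [localCond_letter, ← borderedWord_eq_getD σ b (by omega),
      ← borderedWord_eq_getD σ b (by omega)]
    have hb : borderedWord σ b (i + 1) = letter (σ i) := by simp [borderedWord, letter]
    rw [← hb]
    simp [typeOfValue]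
  simp only [key]
  constructor
  · intro h i
    have := h i (by omega)
    simpa [permWord] using this
  · intro h i hi
    have := h ⟨i, by omega⟩
    simpa [permWord] using this

theorem coe_permWord (σ : Equiv.Perm (Fin n)) :
    (permWord σ : Multiset (WithBot (WithTop ℕ))) = content n 0 := by
  have h : (permWord σ).Perm (List.ofFn fun i : Fin n => letter i) :=
    σ.ofFn_comp_perm fun i : Fin n => letter i
  rw [Multiset.coe_eq_coe.2 h]
  simp only [content, Multiset.replicate_zero, zero_add, Multiset.range, Multiset.map_coe]
  congr 1
  apply List.ext_getElem <;> simp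

theorem permWord_injective : Function.Injective (permWord (n := n)) := by
  intro σ τ h
  have h1 := List.ofFn_injective h
  ext i
  exact congrArg Fin.val (Fin.val_injective (letter_injective (congrFun h1 i)))

/-- Such a word has `n` distinct letters, all from the first `n`, so reading it off gives an
injective self-map of `Fin n`. -/
theorem exists_permWord {w : List (WithBot (WithTop ℕ))}
    (hw : (w : Multiset (WithBot (WithTop ℕ))) = content n 0) :
    ∃ σ : Equiv.Perm (Fin n), permWord σ = w := by
  have hlen : w.length = n := by
    rw [← Multiset.coe_card, hw]
    simp [content]
  have hnd : w.Nodup := by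
    rw [← Multiset.coe_nodup, hw]
    simpa [content] using (Multiset.nodup_range n).map letter_injective
  have hex : ∀ i : Fin n, ∃ j : Fin n, letter j = w[i] := by
    intro i
    have hmem : w[i] ∈ content n 0 := by
      rw [← hw, Multiset.mem_coe]
      exact List.getElem_mem _
    simp only [content, Multiset.replicate_zero, zero_add, Multiset.mem_map,
      Multiset.mem_range] at hmem
    obtain ⟨j, hj, h⟩ := hmem
    exact ⟨⟨j, hj⟩, h⟩
  choose f hf using hex
  have hinj : Function.Injective f := by
    intro i j hij
    have h := (hf i).symm.trans ((congrArg (fun v : Fin n => letter v) hij).trans (hf j))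
    exact Fin.ext ((hnd.getElem_inj_iff).1 h)
  refine ⟨Equiv.ofBijective f (Finite.injective_iff_bijective.1 hinj), ?_⟩
  apply List.ext_getElem
  · simp [permWord, hlen]
  · intro i h1 h2
    simp [permWord, hf]

/-- The right border of permutations, as a part of words. -/
def rightBorder : Bool → WithBot (WithTop ℕ)
  | false => ⊥
  | true => ⊤

-- A right border `+∞` is absorbed as a final letter `⊤`; its own condition holds because the
-- permutation itself contains no `⊤`.
open Classical in
theorem card_filter_typeOfValue (e : Bool) (t : ℕ → OrdinalType) (n : ℕ) :
    (Finset.univ.filter fun σ : Equiv.Perm (Fin n) =>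
      ∀ v, typeOfValue σ (rightBorder e) v = t v).card =
    (words e t n (if e = true then 1 else 0)).card := by
  rw [← Finset.card_image_of_injective (f := fun σ => permWord σ ++ if e = true then [⊤] else [])
    _ (fun σ τ h => permWord_injective (List.append_cancel_right h))]
  congr 1
  ext w
  simp only [Finset.mem_image, Finset.mem_filter, Finset.mem_univ, true_and, mem_words,
    ← allLocal_permWord]
  cases e
  · simp only [rightBorder, Bool.false_eq_true, if_false, List.append_nil, false_imp_iff, and_true]
    constructor
    · rintro ⟨σ, h, rfl⟩
      exact ⟨coe_permWord σ, h⟩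
    · rintro ⟨hw, h⟩
      obtain ⟨σ, rfl⟩ := exists_permWord hw
      exact ⟨σ, h, rfl⟩
  · simp only [rightBorder, if_true, true_imp_iff]
    have hlast : ∀ σ : Equiv.Perm (Fin n), (permWord σ).getLastD ⊥ ≠ ⊤ := by
      intro σ h
      rcases List.eq_nil_or_concat' (permWord σ) with h' | ⟨A, x, h'⟩
      · simp [h'] at h
      · rw [h', List.getLastD_concat] at h
        have hx : x ∈ permWord σ := by simp [h']
        simp [h, permWord, letter_ne_top] at hx
    have hcontent : ∀ A : List (WithBot (WithTop ℕ)),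
        ((A ++ [⊤] : List _) : Multiset (WithBot (WithTop ℕ))) = content n 1 ↔
          (A : Multiset (WithBot (WithTop ℕ))) = content n 0 := by
      intro A
      rw [coe_append_cons, content_succ_right, Multiset.cons_inj_right, List.append_nil]
    constructor
    · rintro ⟨σ, h, rfl⟩
      refine ⟨(hcontent _).2 (coe_permWord σ), ?_, by simp⟩
      simpa [allLocal_append, AllLocal, localCond_top, h] using hlast σ
    · rintro ⟨hw, h, hl⟩
      rcases List.eq_nil_or_concat' w with rfl | ⟨A, x, rfl⟩
      · simp at hl
      · obtain rfl : x = ⊤ := by simpa using hl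
        obtain ⟨σ, rfl⟩ := exists_permWord ((hcontent A).1 hw)
        exact ⟨σ, by simpa using ((allLocal_append _ _ _ _).1 h).1, rfl⟩

theorem mem_Icc_block_iff {r : ℕ} (hr : 1 ≤ r) (j u : ℕ) :
    u + 1 ∈ Finset.Icc (j * r + 1) (j * r + r) ↔ u / r = j := by
  rw [Finset.mem_Icc, Nat.div_eq_iff (by omega)]
  omega

open Classical in
/-- If the values of `Fin n` meet exactly the first `m` blocks, repeated permutations are
classified by the types of these blocks. -/
theorem countRepeated_eq_sum {r m : ℕ} (hr : 1 ≤ r) (e : Bool) (h1 : ∀ v < n, v / r < m)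
    (h2 : ∀ j < m, r * j < n) :
    countRepeated r (rightBorder e) n =
      ∑ s : Fin m → OrdinalType, (words e (blockTypes r s) n (if e = true then 1 else 0)).card := by
  simp only [← card_filter_typeOfValue]
  -- Fibre over the block types, each read off at the smallest value of its block.
  rw [countRepeated, Nat.card_eq_fintype_card, Fintype.card_subtype,
    Finset.card_eq_sum_card_fiberwise (t := Finset.univ)
      (f := fun σ => fun j : Fin m => typeOfValue σ (rightBorder e) ⟨r * j, h2 j j.2⟩)
      (fun _ _ => Finset.mem_coe.2 (Finset.mem_univ _))]
  refine Finset.sum_congr rfl fun s _ => ?_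
  congr 1
  ext σ
  simp only [Finset.mem_filter, Finset.mem_univ, true_and, IsRepeated, mem_Icc_block_iff hr]
  have hdiv : ∀ j, r * j / r = j := fun j => Nat.mul_div_cancel_left j (by omega)
  constructor
  · rintro ⟨h, rfl⟩ v
    rw [blockTypes, dif_pos (h1 v v.2)]
    exact h (v / r) _ _ rfl (hdiv _)
  · intro h
    constructor
    · intro j u v hu hv
      simp only [h, blockTypes, hu, hv]
    · ext j
      simp [h, blockTypes, hdiv]

theorem countRepeated_even {r : ℕ} (hr : 1 ≤ r) (ν : ℕ) :
    countRepeated r ⊤ (r * ν) = blockCount true r ν 1 :=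
  countRepeated_eq_sum hr true (fun _ hv => Nat.div_lt_of_lt_mul hv)
    (fun _ hj => Nat.mul_lt_mul_of_pos_left hj (by omega))

/-- All neighbours of the largest value are smaller when no `⊤` is left. A direct argument is needed
since for a valley no `k'` satisfies the balance in `card_words_succ`. -/
theorem card_words_succ_zero {t : ℕ → OrdinalType} {e : Bool} {m : ℕ} (ht : t m ≠ .peak) :
    (words e t (m + 1) 0).card = 0 := by
  rw [Finset.card_eq_zero, Finset.eq_empty_iff_forall_notMem]
  intro w hw
  obtain ⟨h, hl, -⟩ := mem_words.1 hw
  have hcount : w.count ⊤ = 0 := by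
    rw [← Multiset.coe_count, h, count_top_content]
  obtain ⟨A, B, rfl⟩ := exists_insertLetter h hl
  rw [List.count_eq_zero] at hcount
  apply hcount
  cases hT : t m <;> simp_all [insertLetter, leftPattern, rightPattern]

theorem countRepeated_odd {r : ℕ} (hr : 1 ≤ r) (ν : ℕ) :
    countRepeated r ⊥ (r * ν + 1) = blockCount false r ν 1 := by
  -- The extra block meets only the maximal value, which must be a peak and fills the single
  -- remaining `⊤`.
  have h := countRepeated_eq_sum (n := r * ν + 1) (m := ν + 1) hr false
    (fun v hv => Nat.div_lt_of_lt_mul (by rw [mul_add_one]; omega))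
    (fun j hj => Nat.lt_succ_of_le (Nat.mul_le_mul_left r (Nat.le_of_lt_succ hj)))
  have hlast : ∀ (s : Fin ν → OrdinalType) (T : OrdinalType),
      blockTypes r (Fin.snoc s T : Fin (ν + 1) → OrdinalType) (r * ν) = T :=
    fun s T => blockTypes_snoc_add (i := 0) s T hr
  have hpeak : ∀ s : Fin ν → OrdinalType,
      (words false (blockTypes r (Fin.snoc s .peak : Fin (ν + 1) → OrdinalType)) (r * ν + 1) 0).card =
        (words false (blockTypes r s) (r * ν) 1).card := by
    intro s
    rw [card_words_succ (k' := 1) (by simp [hlast, leftPattern, rightPattern]), hlast,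
      card_words_snoc]
    simp [slots]
  have hzero : ∀ (s : Fin ν → OrdinalType) (T : OrdinalType), T ≠ .peak →
      (words false (blockTypes r (Fin.snoc s T : Fin (ν + 1) → OrdinalType))
        (r * ν + 1) 0).card = 0 :=
    fun s T hT => card_words_succ_zero (by rwa [hlast])
  rw [sum_snoc, sum_ordinalType] at h
  simpa [hpeak, hzero, blockCount, rightBorder] using h

end Permutations

/-! ### Weights of the two continued fractions -/

section Main

variable {r : ℕ}

/-- The number of words with `n` complete blocks of values and `rj + 1` times `⊤` satisfies the
recurrence of weighted Motzkin paths from height `j`. -/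
theorem hasCFExpansion_blockCount (hr : 1 ≤ r) (e : Bool) (s : ℕ) (F : PowerSeries ℚ)
    (a d : ℕ → PowerSeries ℚ)
    (ha : ∀ k, a k = PowerSeries.C
      (((∏ i ∈ Finset.range r, slots e .peak (r * k + 2 + i)) *
        ∏ i ∈ Finset.range r, slots e .valley (r * k + 1 + i) : ℕ) : ℚ) *
          PowerSeries.X ^ (2 * r))
    (hd : ∀ k, d k = 1 - PowerSeries.C ((slots e .doubleRise (r * k + 1) ^ r +
      slots e .doubleFall (r * k + 1) ^ r : ℕ) : ℚ) * PowerSeries.X ^ r)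
    (hF : F = PowerSeries.X ^ s * dilatedSeries r (fun n => (blockCount e r n 1 : ℚ))) :
    HasCFExpansion F (PowerSeries.X ^ s) a d := by
  refine hasCFExpansion_of_recurrence hr s F a d
    (fun k => ((∏ i ∈ Finset.range r, slots e .peak (r * k + 2 + i) : ℕ) : ℚ))
    -- The rise into height `k` starts at height `k - 1`; the truncated value at `k = 0` is never
    -- used.
    (fun k => ((∏ i ∈ Finset.range r, slots e .valley (r * (k - 1) + 1 + i) : ℕ) : ℚ))
    (fun k => ((slots e .doubleRise (r * k + 1) ^ r +
      slots e .doubleFall (r * k + 1) ^ r : ℕ) : ℚ))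
    (fun n k => (blockCount e r n (r * k + 1) : ℚ)) ?_ hd ?_ ?_ ?_ ?_ hF
  · intro k
    rw [ha, Nat.add_sub_cancel, Nat.cast_mul]
  · simp [blockCount_zero_one]
  · intro j
    obtain ⟨q, hq⟩ := Nat.exists_eq_add_of_le' hr
    have : r * (j + 1) + 1 = (r * j + q) + 2 := by rw [mul_add_one]; omega
    rw [this, blockCount_zero, Nat.cast_zero]
  · intro n
    have := blockCount_succ_one (e := e) hr n
    simp only [mul_zero, zero_add, mul_one]
    exact_mod_cast this
  · intro n j
    have h := blockCount_succ (e := e) (r := r) n (r * j + 1)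
    have h1 : r * j + 1 + r = r * (j + 1) + 1 := by ring
    have h2 : r * (j + 1) + 1 + r = r * (j + 2) + 1 := by ring
    have h3 : r * (j + 1) + 1 + 1 = r * (j + 1) + 2 := by ring
    rw [h1, h2, h3] at h
    simp only [Nat.add_sub_cancel]
    exact_mod_cast h

theorem oddOGF_eq (hr : 1 ≤ r) : oddOGF r =
    PowerSeries.X ^ 1 * dilatedSeries r (fun n => (blockCount false r n 1 : ℚ)) := by
  ext m
  simp only [oddOGF, dilatedSeries, PowerSeries.coeff_X_pow_mul', PowerSeries.coeff_mk]
  by_cases h : ∃ ν, m = r * ν + 1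
  · rw [if_pos h]
    obtain ⟨ν, rfl⟩ := h
    rw [countRepeated_odd hr, if_pos (by omega), Nat.add_sub_cancel, if_pos (dvd_mul_right r ν),
      Nat.mul_div_cancel_left ν (by omega)]
  · rw [if_neg h]
    split_ifs with h1 h2
    · obtain ⟨ν, hν⟩ := h2
      exact (h ⟨ν, by omega⟩).elim
    · rfl
    · rfl

theorem evenOGF_eq (hr : 1 ≤ r) : evenOGF r =
    PowerSeries.X ^ 0 * dilatedSeries r (fun n => (blockCount true r n 1 : ℚ)) := by
  ext m
  simp only [evenOGF, dilatedSeries, pow_zero, one_mul, PowerSeries.coeff_mk]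
  by_cases h : ∃ ν, m = r * ν
  · rw [if_pos h]
    obtain ⟨ν, rfl⟩ := h
    rw [countRepeated_even hr, if_pos (dvd_mul_right r ν), Nat.mul_div_cancel_left ν (by omega)]
  · rw [if_neg h]
    exact (if_neg h).symm

theorem hasCFExpansion_oddOGF (hr : 1 ≤ r) :
    HasCFExpansion (oddOGF r) PowerSeries.X (oddNum r) (oddDen r) := by
  have h := hasCFExpansion_blockCount hr false 1 (oddOGF r) (oddNum r) (oddDen r) (fun k => ?_)
    (fun k => ?_) (oddOGF_eq hr)
  · rwa [pow_one] at h
  · rw [oddNum]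
    congr 3
    obtain ⟨q, rfl⟩ := Nat.exists_eq_add_of_le' hr
    have hIcc : ∀ f : ℕ → ℕ, ∏ i ∈ Finset.Icc 2 (q + 1), f i = ∏ i ∈ Finset.range q, f (2 + i) := by
      intro f
      rw [← Finset.Ico_add_one_right_eq_Icc, Finset.prod_Ico_eq_prod_range]
      rfl
    simp only [slots, Bool.false_eq_true, false_and, if_false]
    -- The peak product covers `rk+2, …, rk+r+1` and the valley product `rk+1, …, rk+r`: the overlap
    -- is squared and the two extreme factors stay single.
    rw [hIcc, Finset.prod_pow, Finset.prod_range_succ, Finset.prod_range_succ' _ q]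
    have h1 : ∀ i, (q + 1) * k + 1 + (i + 1) = (q + 1) * k + (2 + i) := fun i => by ring
    simp only [h1, add_assoc]
    ring
  · rw [oddDen]
    simp [slots, two_mul]

theorem hasCFExpansion_evenOGF (hr : 1 ≤ r) :
    HasCFExpansion (evenOGF r) 1 (evenNum r) (evenDen r) := by
  have h := hasCFExpansion_blockCount hr true 0 (evenOGF r) (evenNum r) (evenDen r) (fun k => ?_)
    (fun k => ?_) (evenOGF_eq hr)
  · rwa [pow_zero] at h
  · rw [evenNum]
    congr 3
    -- The slot lost to the final `⊤` lowers each peak factor by one, so the peak and valley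
    -- products coincide.
    have h1 : ∀ i, r * k + (2 + i) - 1 = r * k + (1 + i) := fun i => by omega
    rw [← Finset.Ico_add_one_right_eq_Icc, Finset.prod_Ico_eq_prod_range, Finset.prod_pow]
    simp [slots, rightPattern, h1, sq, add_assoc]
  · rw [evenDen]
    simp [slots, rightPattern, add_comm]

end Main

end RepeatedPerm

theorem mainTheorem6 (r : ℕ) (hr : 1 ≤ r) :
    (RepeatedPerm.HasCFExpansion (RepeatedPerm.oddOGF r) PowerSeries.X
        (RepeatedPerm.oddNum r) (RepeatedPerm.oddDen r) ∧
      RepeatedPerm.IsPolynomialInDepth (RepeatedPerm.oddNum r) (2 * r) ∧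
      RepeatedPerm.IsPolynomialInDepth (RepeatedPerm.oddDen r) r) ∧
    (RepeatedPerm.HasCFExpansion (RepeatedPerm.evenOGF r) 1
        (RepeatedPerm.evenNum r) (RepeatedPerm.evenDen r) ∧
      RepeatedPerm.IsPolynomialInDepth (RepeatedPerm.evenNum r) (2 * r) ∧
      RepeatedPerm.IsPolynomialInDepth (RepeatedPerm.evenDen r) r) := by
  exact ⟨⟨RepeatedPerm.hasCFExpansion_oddOGF hr, RepeatedPerm.isPolynomialInDepth_oddNum hr,
      RepeatedPerm.isPolynomialInDepth_oddDen hr⟩,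
    RepeatedPerm.hasCFExpansion_evenOGF hr, RepeatedPerm.isPolynomialInDepth_evenNum hr,
    RepeatedPerm.isPolynomialInDepth_evenDen hr⟩
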